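/- Let $n \ge 2$ and let $K \subset \mathbb{R}^n$ be a compact convex set containing the origin in its interior, with Minkowski functional $L$ (so $L(v)>0$ and $v/L(v) \in \partial K$ for $v \ne 0$, and $L(0)=0$). Assume that $L$ is a Finsler-Minkowski functional: $L$ is of class $C^4$ near every nonzero vector, and the Hessian of $\tfrac12 L^2$ is positive definite at every nonzero vector. For $p \in \operatorname{int} K$ let $L_p$ be the Minkowski functional of $K_p := K - p$ (equivalently, $L(p + v/L_p(v)) = 1$ for $v \neq 0$), let $g_{ij} = \tfrac12\, \partial^2 L_p^2/\partial y^j \partial y^i$, and define the area function of the Funk manifold $\operatorname{int} K$ by $$ r(p) = \int_{\partial K_p} \mu_p, \qquad \mu_p = \sqrt{\det g_{ij}}\, \sum_{i=1}^n (-1)^{i-1} y^i\, dy^1\wedge\dots\wedge \widehat{dy^i} \wedge \dots \wedge dy^n . $$ Then $r(p) \to \infty$ as $L(p) \to 1^-$; that is, for every real $M$ there is an $\varepsilon > 0$ such that $r(p) > M$ for every $p \in \operatorname{int} K$ with $L(p) > 1 - \varepsilon$. Moreover, $r$ is strictly convex on $\operatorname{int} K$, and its minimum over $\operatorname{int} K$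 is attained at a unique point of $\operatorname{int} K$. -/

import Mathlib

open Set Filter Topology MeasureTheory

noncomputable section

namespace FunkArea

/-- The standard real coordinate space `ℝⁿ` with its canonical inner product. -/
abbrev E (n : ℕ) : Type := EuclideanSpace ℝ (Fin n)

/-- The energy function `(1/2) L²` of a functional `L` on `ℝⁿ`. -/
def energy {n : ℕ} (L : E n → ℝ) (y : E n) : ℝ := (1 / 2) * L y ^ 2

/-- The Riemann-Finsler metric `g_{ij} = ∂²((1/2)L²) / ∂y^j ∂y^i` at the point `v`. -/
def metricMatrix {n : ℕ} (L : E n → ℝ) (v : E n) : Matrix (Fin n) (Fin n) ℝ :=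
  Matrix.of fun i j =>
    fderiv ℝ (fun y => fderiv ℝ (energy L) y (EuclideanSpace.single i 1)) v
      (EuclideanSpace.single j 1)

/-- A functional on `ℝⁿ` is Finsler-Minkowski if around each nonzero vector it is of class `C⁴`
and the Hessian of its energy function is positive definite there. -/
structure IsFinslerMinkowski {n : ℕ} (L : E n → ℝ) : Prop where
  contDiffAt : ∀ v : E n, v ≠ 0 → ContDiffAt ℝ 4 L v
  posDef : ∀ v : E n, v ≠ 0 → (metricMatrix L v).PosDef

/-- The body `K` seen from the point `p` as the new origin: `K_p = K - p`. -/
def bodyAt {n : ℕ} (K : Set (E n)) (p : E n) : Set (E n) := {v | p + v ∈ K}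

/-- The Funk metric of `K`: `funk K p` is the Minkowski functional `L_p` of `K - p`. For `p` in the
interior of `K` and `v ≠ 0` it is the positive number for which `p + v / L_p(v)` lies on the
boundary of `K`. -/
def funk {n : ℕ} (K : Set (E n)) (p : E n) : E n → ℝ := gauge (bodyAt K p)

/-- The radial parametrization `θ ↦ θ / L(θ)` of the indicatrix `{L = 1}` by the Euclidean unit
sphere, extended to all of `ℝⁿ`. -/
def radial {n : ℕ} (L : E n → ℝ) (y : E n) : E n := (L y)⁻¹ • y

/-- For a map `Φ` and a Euclidean unit vector `θ`: the linear map which sends `θ` to `Φ(θ)` and each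
`w ⊥ θ` to `dΦ_θ(w)`. If `(θ, e₁, …, eₙ₋₁)` is a positively oriented orthonormal basis, then its
determinant is the determinant of the vectors `Φ(θ), dΦ_θ(e₁), …, dΦ_θ(eₙ₋₁)`. In other words, it
is the value on `(e₁, …, eₙ₋₁)` of the pullback by `Φ` of the form
`ι_C (dy¹ ∧ … ∧ dyⁿ) = ∑ᵢ (-1)^(i-1) yⁱ dy¹ ∧ … (omit dyⁱ) … ∧ dyⁿ`, with `C` the Liouville vector
field. -/
def tangentFrame {n : ℕ} (Φ : E n → E n) (θ : E n) : E n →L[ℝ] E n :=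
  (innerSL ℝ θ).smulRight (Φ θ) +
    (fderiv ℝ Φ θ).comp (ContinuousLinearMap.id ℝ (E n) - (innerSL ℝ θ).smulRight θ)

/-- The integral `∫_{∂K} f μ` of a function `f` over the indicatrix `∂K = {L = 1}` with respect to
the induced Riemannian volume form
`μ = √(det g_{ij}) ∑ᵢ (-1)^(i-1) yⁱ dy¹ ∧ … (omit dyⁱ) … ∧ dyⁿ`,
computed by pulling `f μ` back to the Euclidean unit sphere (with its surface measure) by the
radial parametrization. -/
def indicatrixIntegral {n : ℕ} (L : E n → ℝ) (f : E n → ℝ) : ℝ :=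
  ∫ θ : Metric.sphere (0 : E n) 1,
    f (radial L θ) * (Real.sqrt (metricMatrix L (radial L θ)).det *
      (tangentFrame (radial L) θ).det) ∂((volume : Measure (E n)).toSphere)

/-- The area function `r(p) = ∫_{∂K_p} 1 μ_p` of the Funk manifold of `K`. -/
def area {n : ℕ} (K : Set (E n)) (p : E n) : ℝ := indicatrixIntegral (funk K p) fun _ => 1

end FunkArea

end

/-!
Let `L` be the Minkowski functional of `K`. The map `T x = x - L(x) p` carries the indicatrix of `K`
to that of `K - p`, and `L_p ∘ T = L`. Differentiating this identity twice
(`IsBody.hessForm_funk_shift`) gives the metric of `L_p` in terms of that of `L`; since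
`det dT = 1 - dL(p)` and passing from one metric to the other is a rank-one perturbation of a scalar
map, `det g` changes by an explicit power of `1 - dL(p)` (`IsBody.det_metricMatrix_funk_shift`). In
polar coordinates `r(p)` is `n` times the integral of `√(det g)` over the interior of `K - p`, and
the change of variables `T` leads to the formula

  `r(p) = n ∫_K √(det g(x)) (1 - dL_x(p)) ^ (-(n - 1) / 2) dx`   (`IsBody.area_eq`),

where `g` is the metric of `L` and only the last factor depends on `p`.

Strict convexity is then that of `s ↦ s ^ (-(n - 1) / 2)`, because `dL_x(p) ≤ L(p) < 1` and `dL_x`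
separates two given points for all `x` in some nonempty open set (`IsBody.strictConvexOn_area`).

For `q ∈ ∂K` the integral diverges: by Taylor's formula `1 - dL_x(q)` is at most a constant times
`ρ²`, where `ρ` is comparable to the distance of `x` to the ray through `q`, so the density is of
order at least `ρ ^ (-(n - 1))` transversally to the ray, in `n - 1` transversal dimensions. The divergence is only
logarithmic: each dyadic shell around the ray contributes a fixed positive amount
(`IsBody.setLIntegral_extAreaDensity_eq_top`). Fatou's lemma and compactness of `K` turn this into
the uniform divergence of `r` at the boundary (`IsBody.exists_lt_area`). A minimum exists by
compactness of the sets `{L ≤ 1 - ε}` and is unique by strict convexity.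
-/

noncomputable section

open scoped ENNReal NNReal

namespace FunkArea

/-! ### The Minkowski functional of a convex body and of its translates -/

section

/-- A convex body of `ℝⁿ` with the origin in its interior. -/
structure IsBody {n : ℕ} (K : Set (E n)) : Prop where
  convex : Convex ℝ K
  isCompact : IsCompact K
  zero_mem : (0 : E n) ∈ interior K

/-- The map `x ↦ x - L(x) p`, with `L` the Minkowski functional of `K`. It sends `t • z`, for
`z ∈ ∂K` and `t ≥ 0`, to `t • (z - p)`, so it carries the indicatrix of `K` to that of `K - p`. -/
def shift {n : ℕ} (K : Set (E n)) (p x : E n) : E n := x - gauge K x • p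

variable {n : ℕ} {K : Set (E n)} {p : E n}

namespace IsBody

lemma mem_nhds (hK : IsBody K) : K ∈ 𝓝 (0 : E n) := mem_interior_iff_mem_nhds.1 hK.zero_mem

lemma absorbent (hK : IsBody K) : Absorbent ℝ K := absorbent_nhds_zero hK.mem_nhds

lemma continuous_gauge (hK : IsBody K) : Continuous (gauge K) :=
  _root_.continuous_gauge hK.convex hK.mem_nhds

lemma gauge_pos (hK : IsBody K) {x : E n} (hx : x ≠ 0) : 0 < gauge K x :=
  (_root_.gauge_pos hK.absorbent
    ((NormedSpace.isVonNBounded_iff ℝ).2 hK.isCompact.isBounded)).2 hx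

lemma gauge_add_le (hK : IsBody K) (x y : E n) : gauge K (x + y) ≤ gauge K x + gauge K y :=
  _root_.gauge_add_le hK.convex hK.absorbent x y

lemma gauge_lt_one (hK : IsBody K) {x : E n} : gauge K x < 1 ↔ x ∈ interior K :=
  gauge_lt_one_iff_mem_interior hK.convex hK.mem_nhds

lemma gauge_eq_one (hK : IsBody K) {x : E n} : gauge K x = 1 ↔ x ∈ frontier K :=
  gauge_eq_one_iff_mem_frontier hK.convex hK.mem_nhds

end IsBody

lemma gauge_smul_nonneg {c : ℝ} (hc : 0 ≤ c) (x : E n) : gauge K (c • x) = c * gauge K x := by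
  rw [gauge_smul_of_nonneg hc, smul_eq_mul]

lemma bodyAt_eq_preimage (K : Set (E n)) (p : E n) :
    bodyAt K p = Homeomorph.addLeft p ⁻¹' K := rfl

lemma IsBody.bodyAt (hK : IsBody K) (hp : p ∈ interior K) : IsBody (bodyAt K p) where
  convex := hK.convex.translate_preimage_right p
  isCompact := (Homeomorph.addLeft p).isCompact_preimage.2 hK.isCompact
  zero_mem := by
    rw [bodyAt_eq_preimage, ← Homeomorph.preimage_interior]
    simpa using hp

lemma IsBody.funk_eq_one (hK : IsBody K) (hp : p ∈ interior K) {v : E n} :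
    funk K p v = 1 ↔ gauge K (p + v) = 1 := by
  rw [funk, (hK.bodyAt hp).gauge_eq_one, hK.gauge_eq_one, bodyAt_eq_preimage,
    ← Homeomorph.preimage_frontier]
  rfl

lemma funk_smul_nonneg {c : ℝ} (hc : 0 ≤ c) (x : E n) : funk K p (c • x) = c * funk K p x :=
  gauge_smul_nonneg hc x

lemma shift_smul_nonneg {c : ℝ} (hc : 0 ≤ c) (x : E n) :
    shift K p (c • x) = c • shift K p x := by
  simp only [shift, gauge_smul_nonneg hc, smul_sub, mul_smul]

lemma shift_zero : shift K p 0 = 0 := by simp [shift]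

/-- The Funk functional `L_p` pulls back to `L` under `x ↦ x - L(x) p`. -/
lemma IsBody.funk_shift (hK : IsBody K) (hp : p ∈ interior K) (x : E n) :
    funk K p (shift K p x) = gauge K x := by
  rcases eq_or_ne x 0 with rfl | hx
  · simp [shift, funk]
  have hL := hK.gauge_pos hx
  have h1 : funk K p (shift K p ((gauge K x)⁻¹ • x)) = 1 := by
    have : gauge K ((gauge K x)⁻¹ • x) = 1 := by
      rw [gauge_smul_nonneg (inv_nonneg.2 hL.le), inv_mul_cancel₀ hL.ne']
    rw [hK.funk_eq_one hp, shift, this]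
    simpa using this
  rw [shift_smul_nonneg (inv_nonneg.2 hL.le), funk_smul_nonneg (inv_nonneg.2 hL.le)] at h1
  field_simp at h1
  exact h1

lemma IsBody.gauge_add_funk_smul (hK : IsBody K) (hp : p ∈ interior K) (y : E n) :
    gauge K (y + funk K p y • p) = funk K p y := by
  rcases eq_or_ne y 0 with rfl | hy
  · simp [funk]
  have hL : 0 < funk K p y := (hK.bodyAt hp).gauge_pos hy
  have h1 : gauge K (p + (funk K p y)⁻¹ • y) = 1 := by
    rw [← hK.funk_eq_one hp, funk_smul_nonneg (inv_nonneg.2 hL.le), inv_mul_cancel₀ hL.ne']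
  have : y + funk K p y • p = funk K p y • (p + (funk K p y)⁻¹ • y) := by
    rw [smul_add, smul_inv_smul₀ hL.ne', add_comm]
  rw [this, gauge_smul_nonneg hL.le, h1, mul_one]

/-- The map `x ↦ x - L(x) p` as a homeomorphism, with inverse `y ↦ y + L_p(y) p`. -/
def IsBody.shiftHomeomorph (hK : IsBody K) (hp : p ∈ interior K) : E n ≃ₜ E n where
  toFun := shift K p
  invFun y := y + funk K p y • p
  left_inv x := by
    change shift K p x + funk K p (shift K p x) • p = x
    rw [hK.funk_shift hp, shift, sub_add_cancel]
  right_inv y := by simp [hK.gauge_add_funk_smul hp, shift]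
  continuous_toFun := continuous_id.sub (hK.continuous_gauge.smul continuous_const)
  continuous_invFun := continuous_id.add
    ((hK.bodyAt hp).continuous_gauge.smul continuous_const)

lemma IsBody.shift_ne_zero (hK : IsBody K) (hp : p ∈ interior K) {x : E n} (hx : x ≠ 0) :
    shift K p x ≠ 0 := by
  rw [← shift_zero (K := K) (p := p)]
  exact (hK.shiftHomeomorph hp).injective.ne hx

lemma IsBody.image_shift_interior (hK : IsBody K) (hp : p ∈ interior K) :
    shift K p '' interior K = interior (FunkArea.bodyAt K p) := by
  ext y
  rw [← (hK.bodyAt hp).gauge_lt_one]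
  constructor
  · rintro ⟨x, hx, rfl⟩
    exact (hK.funk_shift hp x).trans_lt (hK.gauge_lt_one.2 hx)
  · intro hy
    obtain ⟨x, rfl⟩ := (hK.shiftHomeomorph hp).surjective y
    exact ⟨x, hK.gauge_lt_one.1 ((hK.funk_shift hp x).symm.trans_lt hy), rfl⟩

end

/-! ### Homogeneity and the first two derivatives of the energy -/

section

section Homogeneous

variable {V F : Type*} [NormedAddCommGroup V] [NormedSpace ℝ V] [NormedAddCommGroup F]
  [NormedSpace ℝ F]

/-- Euler's identity for positively `1`-homogeneous maps. -/
lemma fderiv_apply_self_of_homogeneous {f : V → F} {x : V} (hf : DifferentiableAt ℝ f x)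
    (hom : ∀ c : ℝ, 0 < c → f (c • x) = c • f x) : fderiv ℝ f x x = f x := by
  have h1 : HasDerivAt (fun c : ℝ => c • x) x 1 := by
    simpa using (hasDerivAt_id (1 : ℝ)).smul_const x
  have h2 : HasDerivAt (fun c : ℝ => f (c • x)) (fderiv ℝ f x x) 1 := by
    have hf' : HasFDerivAt f (fderiv ℝ f x) ((1 : ℝ) • x) := by
      rw [one_smul]
      exact hf.hasFDerivAt
    exact hf'.comp_hasDerivAt (1 : ℝ) h1
  have h3 : HasDerivAt (fun c : ℝ => c • f x) (f x) 1 := by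
    simpa using (hasDerivAt_id (1 : ℝ)).smul_const (f x)
  refine h2.unique (h3.congr_of_eventuallyEq ?_)
  filter_upwards [lt_mem_nhds (zero_lt_one' ℝ)] with c hc using hom c hc

lemma fderiv_smul_of_homogeneous {f : V → F} (x : V) {c a : ℝ} (hc : c ≠ 0)
    (hom : ∀ y, f (c • y) = (c * a) • f y) : fderiv ℝ f (c • x) = a • fderiv ℝ f x := by
  have h := fderiv_comp_smul (𝕜 := ℝ) (f := f) (x := x) c
  have h' : (fun y => f (c • y)) = (c * a) • f := funext hom
  rw [h', fderiv_const_smul_field, mul_smul] at h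
  exact (smul_right_injective _ hc h).symm

end Homogeneous

variable {n : ℕ} {K : Set (E n)} {p x : E n} {L : E n → ℝ}

lemma IsFinslerMinkowski.differentiableAt (hL : IsFinslerMinkowski L) (hx : x ≠ 0) :
    DifferentiableAt ℝ L x := (hL.contDiffAt x hx).differentiableAt (by norm_num)

lemma contDiffAt_fderiv (hL : ContDiffAt ℝ 4 L x) : ContDiffAt ℝ 3 (fderiv ℝ L) x :=
  hL.fderiv_right (by norm_num)

lemma contDiffAt_energy (hL : ContDiffAt ℝ 4 L x) : ContDiffAt ℝ 4 (energy L) x :=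
  contDiffAt_const.mul (hL.pow 2)

lemma fderiv_energy (hL : DifferentiableAt ℝ L x) :
    fderiv ℝ (energy L) x = L x • fderiv ℝ L x := by
  have h : HasFDerivAt (energy L) _ x := (hL.hasFDerivAt.pow 2).const_mul (1 / 2)
  rw [h.fderiv]
  ext w
  simp
  ring

section Gauge

/-- The derivative of a Minkowski functional at any point is bounded by the functional itself; this
is where subadditivity enters. -/
lemma IsBody.fderiv_gauge_le (hK : IsBody K) (hx : DifferentiableAt ℝ (gauge K) x) (y : E n) :
    fderiv ℝ (gauge K) x y ≤ gauge K y := by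
  have h1 : HasDerivAt (fun t : ℝ => x + t • y) y 0 := by
    simpa using ((hasDerivAt_id (0 : ℝ)).smul_const y).const_add x
  have h2 : HasDerivAt (fun t : ℝ => gauge K (x + t • y)) (fderiv ℝ (gauge K) x y) 0 := by
    have hf' : HasFDerivAt (gauge K) (fderiv ℝ (gauge K) x) (x + (0 : ℝ) • y) := by
      rw [zero_smul, add_zero]
      exact hx.hasFDerivAt
    exact hf'.comp_hasDerivAt (0 : ℝ) h1
  refine le_of_tendsto h2.tendsto_slope_zero_right ?_
  filter_upwards [self_mem_nhdsWithin] with t ht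
  have ht' : 0 < t := ht
  have := hK.gauge_add_le x (t • y)
  rw [gauge_smul_nonneg ht'.le] at this
  simp only [zero_add, zero_smul, add_zero, smul_eq_mul]
  rw [inv_mul_le_iff₀ ht']
  linarith

lemma fderiv_gauge_self (hx : DifferentiableAt ℝ (gauge K) x) :
    fderiv ℝ (gauge K) x x = gauge K x :=
  fderiv_apply_self_of_homogeneous hx fun _ hc => gauge_smul_nonneg hc.le x

lemma fderiv_gauge_smul {c : ℝ} (hc : 0 < c) (x : E n) :
    fderiv ℝ (gauge K) (c • x) = fderiv ℝ (gauge K) x := by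
  rw [fderiv_smul_of_homogeneous (a := 1) x hc.ne' fun y => ?_, one_smul]
  rw [mul_one, gauge_smul_nonneg hc.le, smul_eq_mul]

lemma energy_gauge_smul {c : ℝ} (hc : 0 < c) (x : E n) :
    energy (gauge K) (c • x) = (c * c) • energy (gauge K) x := by
  simp only [energy, gauge_smul_nonneg hc.le, smul_eq_mul]
  ring

lemma fderiv_energy_gauge_smul {c : ℝ} (hc : 0 < c) (x : E n) :
    fderiv ℝ (energy (gauge K)) (c • x) = c • fderiv ℝ (energy (gauge K)) x :=
  fderiv_smul_of_homogeneous (a := c) x hc.ne' fun y => energy_gauge_smul hc y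

lemma metricMatrix_gauge_smul {c : ℝ} (hc : 0 < c) (x : E n) :
    metricMatrix (gauge K) (c • x) = metricMatrix (gauge K) x := by
  ext i j
  simp only [metricMatrix, Matrix.of_apply]
  rw [fderiv_smul_of_homogeneous (a := 1) x hc.ne' fun y => ?_, one_smul]
  rw [fderiv_energy_gauge_smul hc, mul_one, smul_apply]

end Gauge

/-- The Hessian of the energy `(1/2) L²` at `x` as a bilinear form. -/
def hessForm (L : E n → ℝ) (x : E n) : LinearMap.BilinForm ℝ (E n) :=
  (fderiv ℝ (fderiv ℝ (energy L)) x).toBilinForm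

@[simp]
lemma hessForm_apply (L : E n → ℝ) (x u v : E n) :
    hessForm L x u v = fderiv ℝ (fderiv ℝ (energy L)) x u v := rfl

lemma metricMatrix_apply (hL : ContDiffAt ℝ 4 L x) (i j : Fin n) :
    metricMatrix L x i j =
      hessForm L x (EuclideanSpace.single j 1) (EuclideanSpace.single i 1) := by
  have h := ((contDiffAt_fderiv (contDiffAt_energy hL)).differentiableAt
    (by norm_num)).hasFDerivAt.clm_apply (hasFDerivAt_const (EuclideanSpace.single i (1 : ℝ)) x)
  simp only [metricMatrix, Matrix.of_apply]
  rw [h.fderiv]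
  simp

lemma det_metricMatrix (hL : ContDiffAt ℝ 4 L x) :
    (metricMatrix L x).det =
      (LinearMap.BilinForm.toMatrix (EuclideanSpace.basisFun (Fin n) ℝ).toBasis
        (hessForm L x)).det := by
  rw [← Matrix.det_transpose]
  congr 1
  ext i j
  rw [Matrix.transpose_apply, metricMatrix_apply hL, LinearMap.BilinForm.toMatrix_apply]
  simp

/-- The Hessian of the energy in terms of the first two derivatives of `L`. -/
lemma hessForm_eq (hL : ContDiffAt ℝ 4 L x) (u v : E n) :
    hessForm L x u v =
      fderiv ℝ L x u * fderiv ℝ L x v + L x * fderiv ℝ (fderiv ℝ L) x u v := by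
  have hev : fderiv ℝ (energy L) =ᶠ[𝓝 x] fun y => L y • fderiv ℝ L y := by
    filter_upwards [hL.eventually (by decide)] with y hy
    exact fderiv_energy (hy.differentiableAt (by norm_num))
  have h : HasFDerivAt (fun y => L y • fderiv ℝ L y) _ x :=
    (hL.differentiableAt (by norm_num)).hasFDerivAt.smul
    ((contDiffAt_fderiv hL).differentiableAt (by norm_num)).hasFDerivAt
  rw [hessForm_apply, hev.fderiv_eq, h.fderiv]
  simp
  ring

lemma hessForm_gauge_self (hL : ContDiffAt ℝ 4 (gauge K) x) (v : E n) :
    hessForm (gauge K) x x v = gauge K x * fderiv ℝ (gauge K) x v := by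
  rw [hessForm_apply, fderiv_apply_self_of_homogeneous
    ((contDiffAt_fderiv (contDiffAt_energy hL)).differentiableAt (by norm_num))
    fun c hc => fderiv_energy_gauge_smul hc x, fderiv_energy (hL.differentiableAt (by norm_num))]
  rfl

end

/-! ### The Funk functional in terms of the functional of the body -/

section

variable {n : ℕ} {K : Set (E n)} {p x : E n} {L : E n → ℝ}

lemma det_smul_transvection (c : ℝ) (f : E n →ₗ[ℝ] ℝ) (v : E n) :
    LinearMap.det (c • LinearMap.transvection f v) = c ^ n * (1 + f v) := by
  rw [LinearMap.det_smul, LinearMap.transvection.det, finrank_euclideanSpace_fin]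

/-- The derivative of `x ↦ x - L(x) p`. -/
def shiftDeriv (K : Set (E n)) (p x : E n) : E n →L[ℝ] E n :=
  ContinuousLinearMap.id ℝ (E n) - (fderiv ℝ (gauge K) x).smulRight p

@[simp]
lemma shiftDeriv_apply (K : Set (E n)) (p x u : E n) :
    shiftDeriv K p x u = u - fderiv ℝ (gauge K) x u • p := rfl

lemma hasFDerivAt_shift (hx : DifferentiableAt ℝ (gauge K) x) :
    HasFDerivAt (shift K p) (shiftDeriv K p x) x :=
  (hasFDerivAt_id x).sub (hx.hasFDerivAt.smul_const p)

lemma det_shiftDeriv (K : Set (E n)) (p x : E n) :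
    (shiftDeriv K p x).det = 1 - fderiv ℝ (gauge K) x p := by
  have h : (shiftDeriv K p x : E n →ₗ[ℝ] E n) =
      LinearMap.transvection (fderiv ℝ (gauge K) x : E n →ₗ[ℝ] ℝ) (-p) := by
    ext1 u
    simp [LinearMap.transvection.apply, sub_eq_add_neg]
  rw [ContinuousLinearMap.det, h, LinearMap.transvection.det]
  simp [sub_eq_add_neg]

lemma IsBody.fderiv_gauge_lt_one (hK : IsBody K) (hp : p ∈ interior K)
    (hx : DifferentiableAt ℝ (gauge K) x) : fderiv ℝ (gauge K) x p < 1 :=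
  (hK.fderiv_gauge_le hx p).trans_lt (hK.gauge_lt_one.2 hp)

/-- The Funk functional is smooth away from the origin: it is `L` precomposed with the inverse of
the diffeomorphism `x ↦ x - L(x) p`. -/
lemma IsBody.contDiffAt_funk (hK : IsBody K) (hFM : IsFinslerMinkowski (gauge K))
    (hp : p ∈ interior K) {y : E n} (hy : y ≠ 0) : ContDiffAt ℝ 4 (funk K p) y := by
  set T := hK.shiftHomeomorph hp with hT
  obtain ⟨x, rfl⟩ := T.surjective y
  have hx : x ≠ 0 := by
    rintro rfl
    exact hy shift_zero
  have hdet : IsUnit (shiftDeriv K p x).det := by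
    rw [det_shiftDeriv]
    exact (sub_pos.2 (hK.fderiv_gauge_lt_one hp (hFM.differentiableAt hx))).ne'.isUnit
  let A : E n ≃L[ℝ] E n := (shiftDeriv K p x).toContinuousLinearEquivOfDetNeZero hdet.ne_zero
  have hsymm : T.toOpenPartialHomeomorph.symm (T x) = x := T.symm_apply_apply x
  have hS : ContDiffAt ℝ 4 T.toOpenPartialHomeomorph.symm (T x) := by
    refine T.toOpenPartialHomeomorph.contDiffAt_symm (f₀' := A) (mem_univ _) ?_ ?_
    · rw [hsymm]
      exact hasFDerivAt_shift (hFM.differentiableAt hx)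
    · rw [hsymm]
      exact contDiffAt_id.sub ((hFM.contDiffAt x hx).smul contDiffAt_const)
  have hcomp : funk K p = gauge K ∘ T.toOpenPartialHomeomorph.symm := by
    ext z
    obtain ⟨w, rfl⟩ := T.surjective z
    have : T.toOpenPartialHomeomorph.symm (T w) = w := T.symm_apply_apply w
    rw [Function.comp_apply, this]
    exact hK.funk_shift hp w
  rw [hcomp]
  refine ContDiffAt.comp (T x) ?_ hS
  rw [hsymm]
  exact hFM.contDiffAt x hx

/-- The differential of the energy of `L_p` at `x - L(x) p` is a multiple of `dL` at `x`. -/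
lemma IsBody.fderiv_energy_funk_shift (hK : IsBody K) (hFM : IsFinslerMinkowski (gauge K))
    (hp : p ∈ interior K) (hx : x ≠ 0) :
    fderiv ℝ (energy (funk K p)) (shift K p x) =
      (gauge K x * (1 - fderiv ℝ (gauge K) x p)⁻¹) • fderiv ℝ (gauge K) x := by
  have hd := hFM.differentiableAt hx
  have hs := sub_pos.2 (hK.fderiv_gauge_lt_one hp hd)
  -- Differentiate the identity `energy L_p ∘ T = energy L`, then evaluate at `p` to solve for
  -- the unknown value at `p`.
  have h1 : (fderiv ℝ (energy (funk K p)) (shift K p x)).comp (shiftDeriv K p x) =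
      gauge K x • fderiv ℝ (gauge K) x := by
    have he : DifferentiableAt ℝ (energy (funk K p)) (shift K p x) :=
      (contDiffAt_energy (hK.contDiffAt_funk hFM hp (hK.shift_ne_zero hp hx))).differentiableAt
        (by norm_num)
    have h2 := (he.hasFDerivAt.comp x (hasFDerivAt_shift hd)).fderiv
    rw [← h2, ← fderiv_energy hd]
    congr 1
    ext z
    simp [energy, hK.funk_shift hp]
  have h3 (w : E n) := congrArg (fun A : E n →L[ℝ] ℝ => A w) h1
  simp only [ContinuousLinearMap.comp_apply, shiftDeriv_apply, map_sub, map_smul, smul_eq_mul,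
    smul_apply] at h3
  set B := fderiv ℝ (energy (funk K p)) (shift K p x)
  set D := fderiv ℝ (gauge K) x
  ext w
  have hp' : B p = gauge K x * D p / (1 - D p) := by
    rw [eq_div_iff hs.ne']
    linear_combination h3 p
  have := h3 w
  rw [hp'] at this
  rw [smul_apply, smul_eq_mul]
  field_simp
  field_simp at this
  linear_combination this

/-- The pullback of the Hessian of the energy of `L_p` under `x ↦ x - L(x) p`. -/
lemma IsBody.hessForm_funk_shift (hK : IsBody K) (hFM : IsFinslerMinkowski (gauge K))
    (hp : p ∈ interior K) (hx : x ≠ 0) (u v : E n) :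
    hessForm (funk K p) (shift K p x) (shiftDeriv K p x u) (shiftDeriv K p x v) =
      (1 - fderiv ℝ (gauge K) x p)⁻¹ * hessForm (gauge K) x u v +
      (1 - (1 - fderiv ℝ (gauge K) x p)⁻¹) *
        (fderiv ℝ (gauge K) x u * fderiv ℝ (gauge K) x v) := by
  have hc := hFM.contDiffAt x hx
  have hd := hFM.differentiableAt hx
  have hs := sub_pos.2 (hK.fderiv_gauge_lt_one hp hd)
  have hD : HasFDerivAt (fderiv ℝ (gauge K)) (fderiv ℝ (fderiv ℝ (gauge K)) x) x :=
    ((contDiffAt_fderiv hc).differentiableAt (by norm_num)).hasFDerivAt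
  have hE : DifferentiableAt ℝ (fderiv ℝ (energy (funk K p))) (shift K p x) :=
    (contDiffAt_fderiv (contDiffAt_energy (hK.contDiffAt_funk hFM hp
      (hK.shift_ne_zero hp hx)))).differentiableAt (by norm_num)
  have h1 := hE.hasFDerivAt.comp x (hasFDerivAt_shift (p := p) hd)
  have h2 : HasFDerivAt
      (fun z => (gauge K z * (1 - fderiv ℝ (gauge K) z p)⁻¹) • fderiv ℝ (gauge K) z) _ x :=
    (hd.hasFDerivAt.mul ((hasDerivAt_inv hs.ne').comp_hasFDerivAt x
      ((hD.clm_apply (hasFDerivAt_const p x)).const_sub 1))).smul hD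
  have h3 := h1.unique (h2.congr_of_eventuallyEq (by
    filter_upwards [isOpen_ne.mem_nhds hx] with z hz
    exact hK.fderiv_energy_funk_shift hFM hp hz))
  have h4 := congrArg (fun A : E n →L[ℝ] E n →L[ℝ] ℝ => A u (shiftDeriv K p x v)) h3
  rw [hessForm_apply, hessForm_eq hc]
  simp at h4
  simp
  rw [h4]
  field_simp
  ring

/-- The determinant of the metric of `L_p` in terms of that of `L`. -/
lemma IsBody.det_metricMatrix_funk_shift (hK : IsBody K) (hFM : IsFinslerMinkowski (gauge K))
    (hp : p ∈ interior K) (hx : x ≠ 0) :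
    (1 - fderiv ℝ (gauge K) x p) ^ 2 * (metricMatrix (funk K p) (shift K p x)).det =
      (metricMatrix (gauge K) x).det * ((1 - fderiv ℝ (gauge K) x p) ^ (n - 1))⁻¹ := by
  have hc := hFM.contDiffAt x hx
  have hd := hFM.differentiableAt hx
  have hs := sub_pos.2 (hK.fderiv_gauge_lt_one hp hd)
  have hL := hK.gauge_pos hx
  have hn : n ≠ 0 := by
    rintro rfl
    exact hx (Subsingleton.elim _ _)
  set s := 1 - fderiv ℝ (gauge K) x p with hs'
  set D : E n →ₗ[ℝ] ℝ := (fderiv ℝ (gauge K) x : E n →ₗ[ℝ] ℝ) with hD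
  -- `N u = c u + (1 - c) dL(u) x / L(x)` with `c = 1 / s` intertwines the two forms.
  set N : E n →ₗ[ℝ] E n :=
    s⁻¹ • LinearMap.transvection D (((s - 1) * (gauge K x)⁻¹) • x) with hN
  have hdetN : LinearMap.det N = (s ^ (n - 1))⁻¹ := by
    rw [hN, det_smul_transvection, map_smul, hD, ContinuousLinearMap.coe_coe, fderiv_gauge_self hd]
    obtain ⟨m, rfl⟩ := Nat.exists_eq_succ_of_ne_zero hn
    simp only [Nat.succ_eq_add_one, Nat.add_sub_cancel, smul_eq_mul, inv_pow]
    field_simp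
    ring
  have hform : (hessForm (funk K p) (shift K p x)).comp (shiftDeriv K p x : E n →ₗ[ℝ] E n)
      (shiftDeriv K p x : E n →ₗ[ℝ] E n) = (hessForm (gauge K) x).compLeft N := by
    refine LinearMap.ext fun u => LinearMap.ext fun v => ?_
    rw [LinearMap.BilinForm.comp_apply, LinearMap.BilinForm.compLeft_apply]
    simp only [ContinuousLinearMap.coe_coe]
    rw [hK.hessForm_funk_shift hFM hp hx, ← hs', hN]
    simp only [LinearMap.smul_apply, LinearMap.transvection.apply, map_add, map_smul,
      LinearMap.add_apply, hessForm_gauge_self hc, smul_eq_mul, hD, ContinuousLinearMap.coe_coe]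
    field_simp
  set b := (EuclideanSpace.basisFun (Fin n) ℝ).toBasis
  have h := congrArg (fun B => (LinearMap.BilinForm.toMatrix b B).det) hform
  simp only [LinearMap.BilinForm.toMatrix_comp b b, LinearMap.BilinForm.toMatrix_compLeft,
    Matrix.det_mul, Matrix.det_transpose, LinearMap.det_toMatrix] at h
  rw [hdetN, ← ContinuousLinearMap.det, det_shiftDeriv, ← hs'] at h
  rw [det_metricMatrix hc, det_metricMatrix (hK.contDiffAt_funk hFM hp (hK.shift_ne_zero hp hx))]
  linear_combination h

end

/-! ### The area as an integral over the body -/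

section

variable {n : ℕ} {K : Set (E n)} {p x : E n} {L : E n → ℝ}

lemma measurable_metricMatrix_det (L : E n → ℝ) : Measurable fun x => (metricMatrix L x).det := by
  have h (i j : Fin n) : Measurable fun x => metricMatrix L x i j :=
    measurable_fderiv_apply_const ℝ _ _
  simp only [Matrix.det_apply]
  fun_prop

/-- Integration of a positively `0`-homogeneous function over the interior of a body, in polar
coordinates. -/
lemma IsBody.setLIntegral_interior (hK : IsBody K) (hn : n ≠ 0) {F : E n → ℝ≥0∞}
    (hF : Measurable F) (hom : ∀ c : ℝ, 0 < c → ∀ x, F (c • x) = F x) :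
    n * ∫⁻ x in interior K, F x =
      ∫⁻ θ : Metric.sphere (0 : E n) 1, F θ * ENNReal.ofReal ((gauge K θ)⁻¹ ^ n)
        ∂(volume : Measure (E n)).toSphere := by
  have : Nonempty (Fin n) := Fin.pos_iff_nonempty.1 (Nat.pos_of_ne_zero hn)
  set G : E n → ℝ≥0∞ := (interior K).indicator F with hG
  have hGm : Measurable G := hF.indicator isOpen_interior.measurableSet
  have key (θ : Metric.sphere (0 : E n) 1) :
      ∫⁻ r : Ioi (0 : ℝ), G (r.1 • θ.1) ∂Measure.volumeIoiPow (n - 1) =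
        F θ * ENNReal.ofReal ((gauge K θ)⁻¹ ^ n / n) := by
    have hθ : (θ : E n) ≠ 0 := ne_zero_of_mem_unit_sphere θ
    have hL := hK.gauge_pos hθ
    have h1 (r : Ioi (0 : ℝ)) : G (r.1 • θ.1) =
        (Iio (⟨(gauge K θ)⁻¹, inv_pos.2 hL⟩ : Ioi (0 : ℝ))).indicator (fun _ => F θ) r := by
      rw [hG]
      have h2 : r.1 • θ.1 ∈ interior K ↔ r ∈ Iio (⟨(gauge K θ)⁻¹, inv_pos.2 hL⟩ : Ioi (0 : ℝ)) := by
        rw [← hK.gauge_lt_one, gauge_smul_nonneg r.2.out.le, mem_Iio, ← Subtype.coe_lt_coe,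
          lt_inv_comm₀ r.2 hL, inv_eq_one_div, lt_div_iff₀ r.2.out, mul_comm]
      by_cases h : r.1 • θ.1 ∈ interior K
      · rw [indicator_of_mem h, indicator_of_mem (h2.1 h), hom _ r.2]
      · rw [indicator_of_notMem h, indicator_of_notMem (fun h' => h (h2.2 h'))]
    rw [lintegral_congr h1, lintegral_indicator measurableSet_Iio, lintegral_const,
      Measure.restrict_apply_univ, Measure.volumeIoiPow_apply_Iio]
    have hn1 : n - 1 + 1 = n := Nat.succ_pred_eq_of_ne_zero hn
    have hn2 : ((n - 1 : ℕ) : ℝ) + 1 = n := by exact_mod_cast hn1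
    rw [hn1, hn2]
  have hmp := (volume : Measure (E n)).measurePreserving_homeomorphUnitSphereProd
  rw [finrank_euclideanSpace_fin] at hmp
  calc n * ∫⁻ x in interior K, F x
    _ = n * ∫⁻ x, G x := by rw [hG, lintegral_indicator isOpen_interior.measurableSet]
    _ = n * ∫⁻ x : ({0}ᶜ : Set (E n)), G x.1 ∂Measure.comap Subtype.val volume := by
      rw [lintegral_subtype_comap (measurableSet_singleton _).compl G, restrict_compl_singleton]
    _ = n * ∫⁻ z : Metric.sphere (0 : E n) 1 × Ioi (0 : ℝ), G (z.2.1 • z.1.1)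
          ∂(volume : Measure (E n)).toSphere.prod (Measure.volumeIoiPow (n - 1)) := by
      rw [← hmp.lintegral_comp_emb (homeomorphUnitSphereProd (E n)).measurableEmbedding]
      congr 1
      refine lintegral_congr fun x => ?_
      congr 1
      exact (congrArg Subtype.val ((homeomorphUnitSphereProd (E n)).symm_apply_apply x)).symm
    _ = n * ∫⁻ θ : Metric.sphere (0 : E n) 1, F θ * ENNReal.ofReal ((gauge K θ)⁻¹ ^ n / n)
          ∂(volume : Measure (E n)).toSphere := by
      have hm : Measurable fun z : Metric.sphere (0 : E n) 1 × Ioi (0 : ℝ) => G (z.2.1 • z.1.1) :=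
        hGm.comp (by fun_prop)
      rw [lintegral_prod _ hm.aemeasurable]
      simp only [key]
    _ = _ := by
      rw [← lintegral_const_mul']
      · refine lintegral_congr fun θ => ?_
        rw [mul_left_comm, ← ENNReal.ofReal_natCast, ← ENNReal.ofReal_mul (Nat.cast_nonneg _)]
        congr 2
        have : (n : ℝ) ≠ 0 := Nat.cast_ne_zero.2 hn
        field_simp
      · exact ENNReal.natCast_ne_top n

/-- The form `ι_C (dy¹ ∧ … ∧ dyⁿ)` pulls back to `L ^ (-n)` times the surface form of the
unit sphere: the tangent frame is `L⁻¹` times a shear. -/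
lemma det_tangentFrame_radial {θ : E n} (hθ : ‖θ‖ = 1) (hL : DifferentiableAt ℝ L θ)
    (h0 : L θ ≠ 0) : (tangentFrame (radial L) θ).det = (L θ)⁻¹ ^ n := by
  have hd : HasFDerivAt (radial L) _ θ :=
    ((hasDerivAt_inv h0).comp_hasFDerivAt θ hL.hasFDerivAt).smul (hasFDerivAt_id θ)
  set P : E n →L[ℝ] E n := ContinuousLinearMap.id ℝ (E n) - (innerSL ℝ θ).smulRight θ with hP
  have hPθ : P θ = 0 := by simp [hP, hθ]
  have h : (tangentFrame (radial L) θ : E n →ₗ[ℝ] E n) =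
      (L θ)⁻¹ • LinearMap.transvection
        ((-(L θ)⁻¹) • ((fderiv ℝ L θ).comp P : E n →ₗ[ℝ] ℝ)) θ := by
    ext1 u
    have hPu : P u = u - inner ℝ θ u • θ := by simp [hP]
    simp only [tangentFrame, hd.fderiv, ← hP, radial]
    simp [LinearMap.transvection.apply, hPu]
    module
  rw [ContinuousLinearMap.det, h, det_smul_transvection]
  simp [hPθ]

/-- The area as a volume integral over the body seen from `p`. -/
lemma IsBody.area_eq_toReal (hK : IsBody K) (hFM : IsFinslerMinkowski (gauge K)) (hn : n ≠ 0)
    (hp : p ∈ interior K) :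
    area K p = (n * ∫⁻ y in interior (FunkArea.bodyAt K p),
      ENNReal.ofReal √(metricMatrix (funk K p) y).det).toReal := by
  have hB := hK.bodyAt hp
  have hm : Measurable fun y => √(metricMatrix (funk K p) y).det :=
    (measurable_metricMatrix_det _).sqrt
  have hint (θ : Metric.sphere (0 : E n) 1) : (1 : ℝ) *
      (√(metricMatrix (funk K p) (radial (funk K p) θ)).det *
        (tangentFrame (radial (funk K p)) θ).det) =
      √(metricMatrix (funk K p) θ).det * (funk K p θ)⁻¹ ^ n := by
    have hθ : (θ : E n) ≠ 0 := ne_zero_of_mem_unit_sphere θ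
    have hpos : 0 < funk K p θ := hB.gauge_pos hθ
    rw [det_tangentFrame_radial (by simp)
      ((hK.contDiffAt_funk hFM hp hθ).differentiableAt (by norm_num)) hpos.ne', one_mul, radial]
    unfold funk at hpos ⊢
    rw [metricMatrix_gauge_smul (inv_pos.2 hpos)]
  have hnn (θ : E n) : 0 ≤ (funk K p θ)⁻¹ ^ n :=
    pow_nonneg (inv_nonneg.2 (gauge_nonneg _)) _
  rw [hB.setLIntegral_interior hn hm.ennreal_ofReal, area, indicatrixIntegral]
  · simp only [hint]
    rw [integral_eq_lintegral_of_nonneg_ae]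
    · congr 1
      refine lintegral_congr fun θ => ?_
      rw [ENNReal.ofReal_mul (Real.sqrt_nonneg _)]
      rfl
    · exact Eventually.of_forall fun θ => mul_nonneg (Real.sqrt_nonneg _) (hnn _)
    · refine Measurable.aestronglyMeasurable ?_
      have hf : Measurable (funk K p) := hB.continuous_gauge.measurable
      exact (hm.comp measurable_subtype_coe).mul
        ((hf.comp measurable_subtype_coe).inv.pow_const n)
  · intro c hc y
    unfold funk
    rw [metricMatrix_gauge_smul hc]

/-- The integrand `√(det g) (1 - dL(p)) ^ (-(n - 1) / 2)` of the area formula, at the point `x`; the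
half-integral power is encoded as the square root of a natural power. Where `dL(p) = 1` and `n ≥ 2`
it has the junk value `0`. -/
def areaDensity (K : Set (E n)) (p x : E n) : ℝ :=
  √(metricMatrix (gauge K) x).det * √((1 - fderiv ℝ (gauge K) x p) ^ (n - 1))⁻¹

lemma measurable_areaDensity (K : Set (E n)) (p : E n) : Measurable (areaDensity K p) :=
  (measurable_metricMatrix_det _).sqrt.mul
    (((measurable_fderiv_apply_const ℝ _ p).const_sub 1).pow_const _).inv.sqrt

lemma areaDensity_nonneg (K : Set (E n)) (p x : E n) : 0 ≤ areaDensity K p x :=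
  mul_nonneg (Real.sqrt_nonneg _) (Real.sqrt_nonneg _)

/-- Change of variables along `x ↦ x - L(x) p`: the Jacobian and the change of the metric combine
to the factor `(1 - dL(p)) ^ (-(n - 1) / 2)`. -/
lemma IsBody.setLIntegral_shift (hK : IsBody K) (hFM : IsFinslerMinkowski (gauge K)) (hn : n ≠ 0)
    (hp : p ∈ interior K) :
    ∫⁻ y in interior (FunkArea.bodyAt K p), ENNReal.ofReal √(metricMatrix (funk K p) y).det =
      ∫⁻ x in interior K, ENNReal.ofReal (areaDensity K p x) := by
  have : Nonempty (Fin n) := Fin.pos_iff_nonempty.1 (Nat.pos_of_ne_zero hn)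
  have hae (U : Set (E n)) : (U \ {0} : Set (E n)) =ᵐ[volume] U :=
    sdiff_null_ae_eq_self (measure_singleton _)
  have hinj : Function.Injective (shift K p) := (hK.shiftHomeomorph hp).injective
  have himg : shift K p '' (interior K \ {0}) = interior (FunkArea.bodyAt K p) \ {0} := by
    rw [image_sdiff hinj, hK.image_shift_interior hp, image_singleton, shift_zero]
  have hs : MeasurableSet (interior K \ {0} : Set (E n)) :=
    isOpen_interior.measurableSet.diff (measurableSet_singleton _)
  rw [← setLIntegral_congr (hae _), ← himg, ← setLIntegral_congr (hae (interior K)),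
    lintegral_image_eq_lintegral_abs_det_fderiv_mul volume hs (f' := shiftDeriv K p)
      (fun x hx => (hasFDerivAt_shift (hFM.differentiableAt hx.2)).hasFDerivWithinAt)
      hinj.injOn]
  refine setLIntegral_congr_fun hs fun x hx => ?_
  have hd := hFM.differentiableAt hx.2
  have hpos := sub_pos.2 (hK.fderiv_gauge_lt_one hp hd)
  rw [det_shiftDeriv, abs_of_pos hpos, ← ENNReal.ofReal_mul hpos.le, areaDensity,
    ← Real.sqrt_mul (hFM.posDef x hx.2).det_pos.le,
    ← hK.det_metricMatrix_funk_shift hFM hp hx.2, Real.sqrt_mul (sq_nonneg _),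
    Real.sqrt_sq hpos.le]

/-- The area as an integral over the fixed body `K`:
`r(p) = n ∫_K √(det g) (1 - dL(p)) ^ (-(n - 1) / 2)`. -/
lemma IsBody.area_eq (hK : IsBody K) (hFM : IsFinslerMinkowski (gauge K)) (hn : n ≠ 0)
    (hp : p ∈ interior K) :
    area K p = n * ∫ x in interior K, areaDensity K p x := by
  rw [hK.area_eq_toReal hFM hn hp, hK.setLIntegral_shift hFM hn hp, ENNReal.toReal_mul,
    ENNReal.toReal_natCast, integral_eq_lintegral_of_nonneg_ae
      (Eventually.of_forall (areaDensity_nonneg K p))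
      (measurable_areaDensity K p).aestronglyMeasurable]

end

/-! ### Strict convexity -/

section

variable {n : ℕ} {K : Set (E n)} {p q x : E n} {L : E n → ℝ}

lemma IsFinslerMinkowski.continuousAt_fderiv_apply (hL : IsFinslerMinkowski L) (hx : x ≠ 0)
    (v : E n) : ContinuousAt (fun y => fderiv ℝ L y v) x :=
  (contDiffAt_fderiv (hL.contDiffAt x hx)).continuousAt.clm_apply continuousAt_const

lemma IsFinslerMinkowski.continuousAt_metricMatrix_det (hL : IsFinslerMinkowski L)
    (hx : x ≠ 0) : ContinuousAt (fun y => (metricMatrix L y).det) x := by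
  have h (i j : Fin n) : ContinuousAt (fun y => metricMatrix L y i j) x := by
    have hc : ContinuousAt (fderiv ℝ (fderiv ℝ (energy L))) x :=
      ((contDiffAt_fderiv (contDiffAt_energy (hL.contDiffAt x hx))).fderiv_right (m := 2)
        (by norm_num)).continuousAt
    have hc' : ContinuousAt (fun y => fderiv ℝ (fderiv ℝ (energy L)) y
        (EuclideanSpace.single j 1) (EuclideanSpace.single i 1)) x :=
      (hc.clm_apply continuousAt_const).clm_apply continuousAt_const
    refine hc'.congr ?_
    filter_upwards [isOpen_ne.mem_nhds hx] with y hy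
    exact (metricMatrix_apply (hL.contDiffAt y hy) i j).symm
  have h' : ContinuousAt (metricMatrix L) x :=
    continuousAt_pi.2 fun i => continuousAt_pi.2 fun j => h i j
  exact (continuous_id.matrix_det).continuousAt.comp h'

lemma IsBody.continuousAt_areaDensity (hK : IsBody K) (hFM : IsFinslerMinkowski (gauge K))
    (hp : p ∈ interior K) (hx : x ≠ 0) : ContinuousAt (areaDensity K p) x := by
  have hpos := sub_pos.2 (hK.fderiv_gauge_lt_one hp (hFM.differentiableAt hx))
  refine (hFM.continuousAt_metricMatrix_det hx).sqrt.mul (ContinuousAt.sqrt ?_)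
  exact ((continuousAt_const.sub (hFM.continuousAt_fderiv_apply hx p)).pow _).inv₀
    (pow_pos hpos _).ne'

lemma areaDensity_smul {c : ℝ} (hc : 0 < c) (p x : E n) :
    areaDensity K p (c • x) = areaDensity K p x := by
  rw [areaDensity, areaDensity, metricMatrix_gauge_smul hc, fderiv_gauge_smul hc]

lemma IsBody.integrableOn_areaDensity (hK : IsBody K) (hFM : IsFinslerMinkowski (gauge K))
    (hn : n ≠ 0) (hp : p ∈ interior K) : IntegrableOn (areaDensity K p) (interior K) := by
  have : Nonempty (Fin n) := Fin.pos_iff_nonempty.1 (Nat.pos_of_ne_zero hn)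
  obtain ⟨C, hC⟩ := (isCompact_sphere (0 : E n) 1).exists_bound_of_continuousOn
    (f := areaDensity K p) fun x hx =>
      (hK.continuousAt_areaDensity hFM hp (ne_zero_of_mem_unit_sphere ⟨x, hx⟩)).continuousWithinAt
  refine Measure.integrableOn_of_bounded (M := C)
    (measure_mono interior_subset |>.trans_lt hK.isCompact.measure_lt_top).ne
    (measurable_areaDensity K p).aestronglyMeasurable ?_
  refine ae_restrict_of_ae ?_
  filter_upwards [compl_mem_ae_iff.2 (measure_singleton (0 : E n))] with x hx
  have hx0 : x ≠ 0 := hx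
  rw [← areaDensity_smul (inv_pos.2 (norm_pos_iff.2 hx0))]
  exact hC _ (by simp [norm_smul, hx0])

/-- `s ↦ s ^ (-m / 2)` is strictly convex. -/
lemma strictConvexOn_sqrt_inv_pow {m : ℕ} (hm : m ≠ 0) :
    StrictConvexOn ℝ (Ioi 0) fun s : ℝ => √(s ^ m)⁻¹ := by
  have hexp (s : ℝ) (hs : 0 < s) : √(s ^ m)⁻¹ = Real.exp (-(m / 2) * Real.log s) := by
    have h0 : 0 ≤ (s ^ m)⁻¹ := by positivity
    rw [Real.sqrt_eq_iff_mul_self_eq h0 (Real.exp_pos _).le, ← Real.exp_add,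
      show -(m / 2 : ℝ) * Real.log s + -(m / 2) * Real.log s = -(m * Real.log s) by ring,
      Real.exp_neg, ← Real.log_pow, Real.exp_log (by positivity)]
  refine ⟨convex_Ioi 0, fun s hs t ht hst a b ha hb hab => ?_⟩
  have hs' : 0 < s := hs
  have ht' : 0 < t := ht
  have hm' : (0 : ℝ) < m / 2 := by positivity
  have hlog := strictConcaveOn_log_Ioi.2 hs ht hst ha hb hab
  simp only [smul_eq_mul] at hlog ⊢
  rw [hexp _ (by positivity), hexp s hs', hexp t ht']
  calc Real.exp (-(m / 2) * Real.log (a * s + b * t))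
    _ < Real.exp (a * (-(m / 2) * Real.log s) + b * (-(m / 2) * Real.log t)) := by
      rw [Real.exp_lt_exp]
      linear_combination (m / 2 : ℝ) * hlog
    _ ≤ _ := convexOn_exp.2 (mem_univ _) (mem_univ _) ha.le hb.le hab

/-- The area function is strictly convex: the integrand is a strictly convex function of `dL(p)`,
and two distinct points are separated by `dL` on an open set of positive measure. -/
lemma IsBody.strictConvexOn_area (hK : IsBody K) (hFM : IsFinslerMinkowski (gauge K))
    (hn : 2 ≤ n) : StrictConvexOn ℝ (interior K) (area K) := by
  have hn0 : n ≠ 0 := by omega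
  have : Nonempty (Fin n) := Fin.pos_iff_nonempty.1 (by omega)
  have hφ := strictConvexOn_sqrt_inv_pow (m := n - 1) (by omega)
  refine ⟨hK.convex.interior, fun p hp q hq hpq a b ha hb hab => ?_⟩
  have hr : a • p + b • q ∈ interior K := hK.convex.interior hp hq ha.le hb.le hab
  have hip := hK.integrableOn_areaDensity hFM hn0 hp
  have hiq := hK.integrableOn_areaDensity hFM hn0 hq
  have hir := hK.integrableOn_areaDensity hFM hn0 hr
  have hsplit (x : E n) : 1 - fderiv ℝ (gauge K) x (a • p + b • q) =
      a • (1 - fderiv ℝ (gauge K) x p) + b • (1 - fderiv ℝ (gauge K) x q) := by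
    simp only [map_add, map_smul, smul_eq_mul]
    linear_combination -hab
  have hle (x : E n) (hx : x ≠ 0) : areaDensity K (a • p + b • q) x ≤
      a * areaDensity K p x + b * areaDensity K q x := by
    have hd := hFM.differentiableAt hx
    have h := hφ.convexOn.2 (sub_pos.2 (hK.fderiv_gauge_lt_one hp hd))
      (sub_pos.2 (hK.fderiv_gauge_lt_one hq hd)) ha.le hb.le hab
    rw [← hsplit] at h
    have h' := mul_le_mul_of_nonneg_left h (Real.sqrt_nonneg (metricMatrix (gauge K) x).det)
    simp only [smul_eq_mul] at h'
    unfold areaDensity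
    linear_combination h'
  have hlt (x : E n) (hx : x ≠ 0) (hx' : 0 < fderiv ℝ (gauge K) x (p - q)) :
      areaDensity K (a • p + b • q) x < a * areaDensity K p x + b * areaDensity K q x := by
    have hd := hFM.differentiableAt hx
    have hne : 1 - fderiv ℝ (gauge K) x p ≠ 1 - fderiv ℝ (gauge K) x q := by
      rw [map_sub] at hx'
      intro h
      linarith
    have h := hφ.2 (sub_pos.2 (hK.fderiv_gauge_lt_one hp hd))
      (sub_pos.2 (hK.fderiv_gauge_lt_one hq hd)) hne ha hb hab
    rw [← hsplit] at h
    have h' := mul_lt_mul_of_pos_left h (Real.sqrt_pos.2 (hFM.posDef x hx).det_pos)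
    simp only [smul_eq_mul] at h'
    unfold areaDensity
    linear_combination h'
  set U : Set (E n) := interior K ∩ ({0}ᶜ ∩ (fun x => fderiv ℝ (gauge K) x (p - q)) ⁻¹' Ioi 0)
    with hU
  have hUo : IsOpen U := by
    refine isOpen_interior.inter (ContinuousOn.isOpen_inter_preimage ?_ isOpen_compl_singleton
      isOpen_Ioi)
    exact fun x hx => (hFM.continuousAt_fderiv_apply hx _).continuousWithinAt
  have hUne : U.Nonempty := by
    have hpq' : p - q ≠ 0 := sub_ne_zero.2 hpq
    have hL := hK.gauge_pos hpq'
    have hc : 0 < (2 * gauge K (p - q))⁻¹ := by positivity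
    refine ⟨(2 * gauge K (p - q))⁻¹ • (p - q), ?_, smul_ne_zero hc.ne' hpq', ?_⟩
    · rw [← hK.gauge_lt_one, gauge_smul_nonneg hc.le]
      field_simp
      norm_num
    · rw [mem_preimage, fderiv_gauge_smul hc, fderiv_gauge_self (hFM.differentiableAt hpq')]
      exact hL
  rw [hK.area_eq hFM hn0 hr, hK.area_eq hFM hn0 hp, hK.area_eq hFM hn0 hq]
  have key : ∫ x in interior K, areaDensity K (a • p + b • q) x <
      ∫ x in interior K, (a * areaDensity K p x + b * areaDensity K q x) := by
    have hsum : Integrable (fun x => a * areaDensity K p x + b * areaDensity K q x)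
        (volume.restrict (interior K)) := (hip.const_mul a).add (hiq.const_mul b)
    have hdiff : Integrable (fun x => a * areaDensity K p x + b * areaDensity K q x -
        areaDensity K (a • p + b • q) x) (volume.restrict (interior K)) := hsum.sub hir
    rw [← sub_pos, ← integral_sub hsum hir, integral_pos_iff_support_of_nonneg_ae ?_ hdiff]
    · refine (pos_iff_ne_zero.2 ?_).trans_le
        (measure_mono (show U ⊆ _ from fun x hx => (sub_pos.2 (hlt x hx.2.1 hx.2.2)).ne'))
      rw [Measure.restrict_apply hUo.measurableSet, inter_eq_left.2 inter_subset_left]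
      exact (hUo.measure_pos volume hUne).ne'
    · refine ae_restrict_of_ae ?_
      filter_upwards [compl_mem_ae_iff.2 (measure_singleton (0 : E n))] with x hx
      exact sub_nonneg.2 (hle x hx)
  rw [integral_add (hip.const_mul a) (hiq.const_mul b), integral_const_mul,
    integral_const_mul] at key
  have hnpos : (0 : ℝ) < n := Nat.cast_pos.2 (by omega)
  have := mul_lt_mul_of_pos_left key hnpos
  simp only [smul_eq_mul]
  linear_combination this

end

/-! ### Behaviour of the density at a boundary point -/

section

variable {n : ℕ} {K : Set (E n)} {p q x : E n} {L : E n → ℝ}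

/-- The area density with values in `[0, ∞]`. For `n ≥ 2` and `det g > 0` it takes the value `∞`
where `dL(p) = 1`, instead of the junk value `0` of `areaDensity`, so that it is also meaningful,
and continuous in `p`, for `p` on the boundary of the body. -/
def extAreaDensity (K : Set (E n)) (p x : E n) : ℝ≥0∞ :=
  ENNReal.ofReal √(metricMatrix (gauge K) x).det *
    (ENNReal.ofReal √((1 - fderiv ℝ (gauge K) x p) ^ (n - 1)))⁻¹

lemma measurable_extAreaDensity (K : Set (E n)) (p : E n) : Measurable (extAreaDensity K p) :=
  (measurable_metricMatrix_det _).sqrt.ennreal_ofReal.mul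
    (((measurable_fderiv_apply_const ℝ _ p).const_sub 1).pow_const _).sqrt.ennreal_ofReal.inv

lemma continuous_extAreaDensity_left (K : Set (E n)) (x : E n) :
    Continuous fun p => extAreaDensity K p x := by
  have h : Continuous fun p : E n =>
      (ENNReal.ofReal √((1 - fderiv ℝ (gauge K) x p) ^ (n - 1)))⁻¹ :=
    continuous_inv.comp (ENNReal.continuous_ofReal.comp (by fun_prop))
  exact ENNReal.continuous_const_mul ENNReal.ofReal_ne_top |>.comp h

lemma extAreaDensity_eq (h : fderiv ℝ (gauge K) x p < 1) :
    extAreaDensity K p x = ENNReal.ofReal (areaDensity K p x) := by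
  rw [extAreaDensity, areaDensity, ENNReal.ofReal_mul (Real.sqrt_nonneg _), Real.sqrt_inv,
    ENNReal.ofReal_inv_of_pos (Real.sqrt_pos.2 (pow_pos (sub_pos.2 h) _))]

lemma extAreaDensity_smul {c : ℝ} (hc : 0 < c) (p x : E n) :
    extAreaDensity K p (c • x) = extAreaDensity K p x := by
  rw [extAreaDensity, extAreaDensity, metricMatrix_gauge_smul hc, fderiv_gauge_smul hc]

lemma IsBody.setLIntegral_extAreaDensity (hK : IsBody K) (hFM : IsFinslerMinkowski (gauge K))
    (hn : n ≠ 0) (hp : p ∈ interior K) :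
    n * ∫⁻ x in interior K, extAreaDensity K p x = ENNReal.ofReal (area K p) := by
  have : Nonempty (Fin n) := Fin.pos_iff_nonempty.1 (Nat.pos_of_ne_zero hn)
  rw [hK.area_eq hFM hn hp, ENNReal.ofReal_mul (Nat.cast_nonneg _), ENNReal.ofReal_natCast,
    ofReal_integral_eq_lintegral_ofReal (hK.integrableOn_areaDensity hFM hn hp)
      (Eventually.of_forall (areaDensity_nonneg K p))]
  congr 1
  refine lintegral_congr_ae (ae_restrict_of_ae ?_)
  filter_upwards [compl_mem_ae_iff.2 (measure_singleton (0 : E n))] with x hx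
  exact extAreaDensity_eq (hK.fderiv_gauge_lt_one hp (hFM.differentiableAt hx))

/-- By Taylor's formula, `dL(q)` agrees with `1` to second order near a boundary point `q`. -/
lemma exists_one_sub_fderiv_gauge_le (hFM : IsFinslerMinkowski (gauge K)) (hq0 : q ≠ 0)
    (hq : gauge K q = 1) :
    ∃ C > (0 : ℝ), ∀ᶠ z in 𝓝 q, 1 - fderiv ℝ (gauge K) z q ≤ C * ‖z - q‖ ^ 2 := by
  obtain ⟨C, t, ht, hC⟩ := ((contDiffAt_fderiv (hFM.contDiffAt q hq0)).of_le
    (m := 1) (by norm_num)).exists_lipschitzOnWith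
  obtain ⟨r, hr, hball⟩ := Metric.mem_nhds_iff.1 (inter_mem ht (isOpen_ne.mem_nhds hq0))
  refine ⟨C + 1, by positivity, ?_⟩
  filter_upwards [Metric.ball_mem_nhds q hr] with z hz
  have hseg : segment ℝ z q ⊆ Metric.ball q r :=
    (convex_ball q r).segment_subset hz (Metric.mem_ball_self hr)
  have h := (convex_segment z q).norm_image_sub_le_of_norm_fderiv_le' (𝕜 := ℝ) (f := gauge K)
    (φ := fderiv ℝ (gauge K) z) (C := C * ‖q - z‖)
    (fun y hy => hFM.differentiableAt (hball (hseg hy)).2) (fun y hy => ?_)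
    (left_mem_segment ℝ z q) (right_mem_segment ℝ z q)
  · rw [map_sub, fderiv_gauge_self (hFM.differentiableAt (hball hz).2), hq] at h
    have h1 := (le_abs_self _).trans h
    rw [norm_sub_rev q z] at h1
    nlinarith [sq_nonneg ‖z - q‖]
  · refine (hC.norm_sub_le (hball (hseg hy)).1 (hball hz).1).trans ?_
    gcongr
    obtain ⟨a, b, ha, hb, hab, rfl⟩ := hy
    have : a • z + b • q - z = b • (q - z) := by
      rw [eq_sub_of_add_eq hab]
      module
    rw [this, norm_smul, Real.norm_of_nonneg hb]
    exact mul_le_of_le_one_left (norm_nonneg _) (by linarith)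

/-- At a boundary point `q` the density is at least of order `|z - q| ^ (-(n - 1))`. -/
lemma IsBody.exists_le_extAreaDensity (hK : IsBody K) (hFM : IsFinslerMinkowski (gauge K)) (hq0 : q ≠ 0)
    (hq : gauge K q = 1) :
    ∃ c > (0 : ℝ), ∀ᶠ z in 𝓝 q, ∀ ρ > 0, ‖z - q‖ ≤ ρ →
      ENNReal.ofReal (c * (ρ ^ (n - 1))⁻¹) ≤ extAreaDensity K q z := by
  obtain ⟨C, hC, hT⟩ := exists_one_sub_fderiv_gauge_le hFM hq0 hq
  have hW : 0 < √(metricMatrix (gauge K) q).det := Real.sqrt_pos.2 (hFM.posDef q hq0).det_pos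
  set W := √(metricMatrix (gauge K) q).det with hWdef
  refine ⟨W / 2 * (√C ^ (n - 1))⁻¹, by positivity, ?_⟩
  filter_upwards [hT, (hFM.continuousAt_metricMatrix_det hq0).sqrt.eventually
    (lt_mem_nhds (half_lt_self hW)), isOpen_ne.mem_nhds hq0] with z hz hz' hz1 ρ hρ hzρ
  have h1 : √((1 - fderiv ℝ (gauge K) z q) ^ (n - 1)) ≤ √C ^ (n - 1) * ρ ^ (n - 1) := by
    rw [Real.sqrt_le_iff]
    refine ⟨by positivity, ?_⟩
    have hz0 : 0 ≤ 1 - fderiv ℝ (gauge K) z q :=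
      sub_nonneg.2 ((hK.fderiv_gauge_le (hFM.differentiableAt hz1) q).trans_eq hq)
    calc (1 - fderiv ℝ (gauge K) z q) ^ (n - 1)
      _ ≤ (C * ρ ^ 2) ^ (n - 1) := pow_le_pow_left₀ hz0 (hz.trans (by gcongr)) _
      _ = (√C ^ 2 * ρ ^ 2) ^ (n - 1) := by rw [Real.sq_sqrt hC.le]
      _ = _ := by rw [mul_pow, ← pow_mul, ← pow_mul]; ring
  rw [mul_assoc, ENNReal.ofReal_mul (by positivity), ← mul_inv, extAreaDensity,
    ENNReal.ofReal_inv_of_pos (by positivity)]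
  gcongr

end

/-! ### Divergence at the boundary -/

section

variable {n : ℕ} {K : Set (E n)} {p q x : E n} {L : E n → ℝ}

/-- A piece of a shell around the line through `q`, where `ℓ` is a linear form with `ℓ q = 1`: the
points `t q + v` with `1/4 < t < 1/2`, `v ∈ ker ℓ` and `ρ / 2 < ‖v‖ < ρ`. -/
def shell (ℓ : E n →L[ℝ] ℝ) (q : E n) (ρ : ℝ) : Set (E n) :=
  {x | ℓ x ∈ Ioo (1 / 4) (1 / 2) ∧ ‖x - ℓ x • q‖ ∈ Ioo (ρ / 2) ρ}

variable {ℓ : E n →L[ℝ] ℝ}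

lemma isOpen_shell (ℓ : E n →L[ℝ] ℝ) (q : E n) (ρ : ℝ) : IsOpen (shell ℓ q ρ) :=
  (isOpen_Ioo.preimage ℓ.continuous).inter
    (isOpen_Ioo.preimage (f := fun x => ‖x - ℓ x • q‖) (by fun_prop))

lemma shell_nonempty (hn : 2 ≤ n) (hq : ℓ q = 1) {ρ : ℝ} (hρ : 0 < ρ) :
    (shell ℓ q ρ).Nonempty := by
  have hker : LinearMap.ker (ℓ : E n →ₗ[ℝ] ℝ) ≠ ⊥ := by
    apply LinearMap.ker_ne_bot_of_finrank_lt
    rw [finrank_euclideanSpace_fin, Module.finrank_self]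
    omega
  obtain ⟨u, hu, hu0⟩ := Submodule.exists_mem_ne_zero_of_ne_bot hker
  have hu' : ℓ u = 0 := hu
  have hun : 0 < ‖u‖ := norm_pos_iff.2 hu0
  have hℓ : ℓ ((3 / 8 : ℝ) • q + (3 / 4 * ρ / ‖u‖) • u) = 3 / 8 := by simp [hq, hu']
  refine ⟨(3 / 8 : ℝ) • q + (3 / 4 * ρ / ‖u‖) • u, ?_, ?_⟩
  · rw [hℓ]
    norm_num
  · rw [hℓ, add_sub_cancel_left, norm_smul, Real.norm_of_nonneg (by positivity)]
    constructor <;> field_simp <;> norm_num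

/-- Shells shrink like `δ ^ (n - 1)`. -/
lemma le_volume_shell (hn : n ≠ 0) (hq : ℓ q = 1) {ρ δ : ℝ} (hδ : 0 < δ) :
    ENNReal.ofReal (δ ^ (n - 1)) * volume (shell ℓ q ρ) ≤ volume (shell ℓ q (δ * ρ)) := by
  -- the linear map which fixes `q` and scales `ker ℓ` by `δ`
  set S : E n →ₗ[ℝ] E n :=
    δ • LinearMap.transvection ((δ⁻¹ - 1) • (ℓ : E n →ₗ[ℝ] ℝ)) q with hS
  have hdet : LinearMap.det S = δ ^ (n - 1) := by
    obtain ⟨m, rfl⟩ := Nat.exists_eq_succ_of_ne_zero hn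
    rw [hS, det_smul_transvection]
    simp only [LinearMap.smul_apply, ContinuousLinearMap.coe_coe, hq, smul_eq_mul,
      Nat.succ_eq_add_one, Nat.add_sub_cancel]
    field_simp
    ring
  have hSx (x : E n) : S x = δ • x + ((1 - δ) * ℓ x) • q := by
    simp only [hS, LinearMap.smul_apply, LinearMap.transvection.apply,
      ContinuousLinearMap.coe_coe, smul_add, smul_smul, smul_eq_mul]
    congr 2
    field_simp
  have hsub : S '' shell ℓ q ρ ⊆ shell ℓ q (δ * ρ) := by
    rintro _ ⟨x, ⟨h1, h2⟩, rfl⟩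
    have hℓ : ℓ (S x) = ℓ x := by
      rw [hSx, map_add, map_smul, map_smul, hq]
      simp only [smul_eq_mul]
      ring
    have hP : S x - ℓ x • q = δ • (x - ℓ x • q) := by
      rw [hSx]
      module
    refine ⟨by rwa [hℓ], ?_⟩
    rw [hℓ, hP, norm_smul, Real.norm_of_nonneg hδ.le]
    constructor
    · rw [mul_div_assoc]
      exact mul_lt_mul_of_pos_left h2.1 hδ
    · exact mul_lt_mul_of_pos_left h2.2 hδ
  calc ENNReal.ofReal (δ ^ (n - 1)) * volume (shell ℓ q ρ)
    _ = volume (S '' shell ℓ q ρ) := by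
      rw [Measure.addHaar_image_linearMap, hdet, abs_of_pos (pow_pos hδ _)]
    _ ≤ _ := measure_mono hsub

lemma pairwise_disjoint_shell (ℓ : E n →L[ℝ] ℝ) (q : E n) (ρ : ℝ) (hρ : 0 < ρ) :
    Pairwise (Function.onFun Disjoint fun k : ℕ => shell ℓ q ((1 / 2) ^ k * ρ)) := by
  refine (pairwise_disjoint_on _).2 fun j k hjk => disjoint_left.2 fun x hj hk => ?_
  have h1 : ((1 / 2 : ℝ)) ^ k ≤ (1 / 2) ^ (j + 1) :=
    pow_le_pow_of_le_one (by norm_num) (by norm_num) hjk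
  have h2 := hj.2.1
  have h3 := hk.2.2
  rw [pow_succ] at h1
  nlinarith

/-- At a boundary point `q` of the body, the integral which defines the area diverges: in terms of
the distance `ρ` to the ray through `q`, the density is of order `ρ ^ (-(n - 1))`, and a shell of
radius `ρ` has volume of order `ρ ^ (n - 1)`, so that each dyadic shell contributes at least a fixed
positive amount. -/
lemma IsBody.setLIntegral_extAreaDensity_eq_top (hK : IsBody K)
    (hFM : IsFinslerMinkowski (gauge K)) (hn : 2 ≤ n) (hq : gauge K q = 1) :
    ∫⁻ x in interior K, extAreaDensity K q x = ∞ := by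
  have hn0 : n ≠ 0 := by omega
  have hq0 : q ≠ 0 := by
    rintro rfl
    simp at hq
  set ℓ : E n →L[ℝ] ℝ := fderiv ℝ (gauge K) q with hℓ
  have hℓq : ℓ q = 1 := by rw [hℓ, fderiv_gauge_self (hFM.differentiableAt hq0), hq]
  obtain ⟨c, hc, hlow⟩ := hK.exists_le_extAreaDensity hFM hq0 hq
  obtain ⟨r, hr, hball⟩ := Metric.eventually_nhds_iff.1 hlow
  have hsmall : ∀ᶠ v in 𝓝 (0 : E n), gauge K v < 1 / 2 :=
    hK.continuous_gauge.continuousAt.eventually (gt_mem_nhds (by simp))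
  obtain ⟨b, hb, hgb⟩ := Metric.eventually_nhds_iff.1 hsmall
  -- The factor `1/4` makes up for the rescaling of points of the shells to the hyperplane `ℓ = 1`,
  -- and `b` keeps the shells inside the body.
  set a : ℝ := min (r / 4) b with ha
  have ha0 : 0 < a := lt_min (by positivity) hb
  have hsub (k : ℕ) : shell ℓ q ((1 / 2) ^ k * a) ⊆ interior K := by
    intro x ⟨h1, h2⟩
    have hk : ((1 / 2 : ℝ)) ^ k * a ≤ a :=
      mul_le_of_le_one_left ha0.le (pow_le_one₀ (by norm_num) (by norm_num))
    have h3 : gauge K (x - ℓ x • q) < 1 / 2 :=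
      hgb (by rw [dist_zero_right]; exact h2.2.trans_le (hk.trans (min_le_right _ _)))
    have h4 := hK.gauge_add_le (x - ℓ x • q) (ℓ x • q)
    rw [sub_add_cancel, gauge_smul_nonneg (by linarith [h1.1]), hq] at h4
    rw [← hK.gauge_lt_one]
    linarith [h1.2]
  have hpt (k : ℕ) (x : E n) (hx : x ∈ shell ℓ q ((1 / 2) ^ k * a)) :
      ENNReal.ofReal (c * ((4 * ((1 / 2) ^ k * a)) ^ (n - 1))⁻¹) ≤ extAreaDensity K q x := by
    obtain ⟨h1, h2⟩ := hx
    have hpos : 0 < ℓ x := lt_trans (by norm_num) h1.1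
    have hk : ((1 / 2 : ℝ)) ^ k * a ≤ a :=
      mul_le_of_le_one_left ha0.le (pow_le_one₀ (by norm_num) (by norm_num))
    have hinv : (ℓ x)⁻¹ ≤ 4 := by
      rw [inv_le_comm₀ hpos (by norm_num)]
      linarith [h1.1]
    have hz : ‖(ℓ x)⁻¹ • x - q‖ < 4 * ((1 / 2) ^ k * a) := by
      have : (ℓ x)⁻¹ • x - q = (ℓ x)⁻¹ • (x - ℓ x • q) := by
        rw [smul_sub, inv_smul_smul₀ hpos.ne']
      rw [this, norm_smul, Real.norm_of_nonneg (inv_pos.2 hpos).le]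
      calc (ℓ x)⁻¹ * ‖x - ℓ x • q‖
        _ ≤ 4 * ‖x - ℓ x • q‖ := by gcongr
        _ < _ := by linarith [h2.2]
    rw [← extAreaDensity_smul (inv_pos.2 hpos)]
    refine hball ?_ _ (by positivity) hz.le
    rw [dist_eq_norm]
    refine hz.trans_le ?_
    have := min_le_left (r / 4) b
    linarith
  set κ : ℝ≥0∞ := ENNReal.ofReal (c * ((4 * a) ^ (n - 1))⁻¹) * volume (shell ℓ q a) with hκ
  have hκ0 : κ ≠ 0 := by
    refine mul_ne_zero ?_ ((isOpen_shell ℓ q a).measure_pos volume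
      (shell_nonempty hn hℓq ha0)).ne'
    rw [ne_eq, ENNReal.ofReal_eq_zero, not_le]
    positivity
  have hint (k : ℕ) : κ ≤ ∫⁻ x in shell ℓ q ((1 / 2) ^ k * a), extAreaDensity K q x := by
    have hδ : (0 : ℝ) < (1 / 2) ^ k := by positivity
    calc κ = ENNReal.ofReal (c * ((4 * ((1 / 2) ^ k * a)) ^ (n - 1))⁻¹) *
          (ENNReal.ofReal (((1 / 2) ^ k) ^ (n - 1)) * volume (shell ℓ q a)) := by
          rw [← mul_assoc, ← ENNReal.ofReal_mul (by positivity), hκ]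
          congr 2
          rw [mul_pow, mul_pow, mul_pow]
          field_simp
      _ ≤ ENNReal.ofReal (c * ((4 * ((1 / 2) ^ k * a)) ^ (n - 1))⁻¹) *
          volume (shell ℓ q ((1 / 2) ^ k * a)) := by
          gcongr
          exact le_volume_shell hn0 hℓq hδ
      _ = ∫⁻ x in shell ℓ q ((1 / 2) ^ k * a),
            ENNReal.ofReal (c * ((4 * ((1 / 2) ^ k * a)) ^ (n - 1))⁻¹) := by
          rw [setLIntegral_const]
      _ ≤ _ := setLIntegral_mono (measurable_extAreaDensity K q) (hpt k)
  rw [eq_top_iff]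
  calc ∞ = ∑' _ : ℕ, κ := (ENNReal.tsum_const_eq_top_of_ne_zero hκ0).symm
    _ ≤ ∑' k : ℕ, ∫⁻ x in shell ℓ q ((1 / 2) ^ k * a), extAreaDensity K q x :=
      ENNReal.tsum_le_tsum hint
    _ = ∫⁻ x in ⋃ k : ℕ, shell ℓ q ((1 / 2) ^ k * a), extAreaDensity K q x :=
      (lintegral_iUnion (fun k => (isOpen_shell _ _ _).measurableSet)
        (pairwise_disjoint_shell ℓ q a ha0) _).symm
    _ ≤ _ := lintegral_mono_set (iUnion_subset hsub)

/-- The area function tends to infinity at the boundary, uniformly. By Fatou's lemma a bound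
along a sequence would persist for the integral at a limit point on the boundary, which diverges. -/
lemma IsBody.exists_lt_area (hK : IsBody K) (hFM : IsFinslerMinkowski (gauge K)) (hn : 2 ≤ n)
    (M : ℝ) : ∃ ε : ℝ, 0 < ε ∧ ∀ p ∈ interior K, 1 - ε < gauge K p → M < area K p := by
  have hn0 : n ≠ 0 := by omega
  by_contra! hcon
  choose u hu hgu hau using fun k : ℕ => hcon (1 / ((k : ℝ) + 1)) (by positivity)
  obtain ⟨q, -, φ, hφ, hlim⟩ := hK.isCompact.tendsto_subseq fun k => interior_subset (hu k)
  have hq : gauge K q = 1 := by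
    have h1 : Tendsto (fun k => gauge K (u (φ k))) atTop (𝓝 (gauge K q)) :=
      hK.continuous_gauge.continuousAt.tendsto.comp hlim
    have h2 : Tendsto (fun k : ℕ => 1 - 1 / ((φ k : ℝ) + 1)) atTop (𝓝 1) := by
      have h3 := (tendsto_one_div_add_atTop_nhds_zero_nat (𝕜 := ℝ)).const_sub 1
      rw [sub_zero] at h3
      exact h3.comp hφ.tendsto_atTop
    exact le_antisymm (le_of_tendsto h1 (Eventually.of_forall fun k =>
      (hK.gauge_lt_one.2 (hu (φ k))).le))
      (le_of_tendsto_of_tendsto h2 h1 (Eventually.of_forall fun k => (hgu (φ k)).le))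
  have htop := hK.setLIntegral_extAreaDensity_eq_top hFM hn hq
  have hfatou : ∫⁻ x in interior K, extAreaDensity K q x ≤
      liminf (fun k => ∫⁻ x in interior K, extAreaDensity K (u (φ k)) x) atTop := by
    refine le_trans (le_of_eq (lintegral_congr fun x => ?_))
      (lintegral_liminf_le fun k => measurable_extAreaDensity K (u (φ k)))
    exact (((continuous_extAreaDensity_left K x).continuousAt.tendsto.comp hlim).liminf_eq).symm
  have hbound (k : ℕ) : ∫⁻ x in interior K, extAreaDensity K (u (φ k)) x ≤ ENNReal.ofReal M := by
    calc ∫⁻ x in interior K, extAreaDensity K (u (φ k)) x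
      _ ≤ n * ∫⁻ x in interior K, extAreaDensity K (u (φ k)) x :=
        le_mul_of_one_le_left zero_le (by exact_mod_cast Nat.one_le_iff_ne_zero.2 hn0)
      _ = ENNReal.ofReal (area K (u (φ k))) := hK.setLIntegral_extAreaDensity hFM hn0 (hu _)
      _ ≤ _ := ENNReal.ofReal_le_ofReal (hau _)
  have hle := hfatou.trans (liminf_le_of_frequently_le' (Frequently.of_forall hbound))
  rw [htop, top_le_iff] at hle
  exact ENNReal.ofReal_ne_top hle

end

end FunkArea

end

theorem theorem4 (n : ℕ) (hn : 2 ≤ n) (K : Set (FunkArea.E n))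
    (hconv : Convex ℝ K) (hcomp : IsCompact K) (h0 : (0 : FunkArea.E n) ∈ interior K)
    (hFM : FunkArea.IsFinslerMinkowski (gauge K)) :
    Tendsto (FunkArea.area K) (comap (gauge K) (𝓝[<] (1 : ℝ))) atTop ∧
    (∀ M : ℝ, ∃ ε : ℝ, 0 < ε ∧ ∀ p ∈ interior K, 1 - ε < gauge K p → M < FunkArea.area K p) ∧
    StrictConvexOn ℝ (interior K) (FunkArea.area K) ∧
    (∃! p : FunkArea.E n, p ∈ interior K ∧ IsMinOn (FunkArea.area K) (interior K) p) := by
  have hK : FunkArea.IsBody K := ⟨hconv, hcomp, h0⟩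
  have hblow := hK.exists_lt_area hFM hn
  have hsc := hK.strictConvexOn_area hFM hn
  refine ⟨?_, hblow, hsc, ?_⟩
  · refine tendsto_atTop.2 fun M => ?_
    obtain ⟨ε, hε, h⟩ := hblow M
    refine mem_of_superset (preimage_mem_comap (Ioo_mem_nhdsLT (show 1 - ε < 1 by linarith))) ?_
    intro p hp
    exact (h p (hK.gauge_lt_one.1 hp.2) hp.1).le
  · obtain ⟨ε, hε, h⟩ := hblow (FunkArea.area K 0)
    set C : Set (FunkArea.E n) := {p | gauge K p ≤ 1 - ε} with hC
    have hCK : C ⊆ interior K := fun p hp => hK.gauge_lt_one.1 (lt_of_le_of_lt hp (by linarith))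
    have hCc : IsCompact C := hK.isCompact.of_isClosed_subset
      (isClosed_le hK.continuous_gauge continuous_const) (hCK.trans interior_subset)
    have h0C : (0 : FunkArea.E n) ∈ C := by
      by_contra hcon
      exact lt_irrefl _ (h 0 h0 (not_le.1 hcon))
    have hcont : ContinuousOn (FunkArea.area K) (interior K) :=
      hsc.convexOn.continuousOn isOpen_interior
    obtain ⟨p, hpC, hmin⟩ := hCc.exists_isMinOn ⟨0, h0C⟩ (hcont.mono hCK)
    have hp : IsMinOn (FunkArea.area K) (interior K) p := by
      intro x hx
      by_cases hxC : x ∈ C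
      · exact hmin hxC
      · exact (hmin h0C).trans (h x hx (not_le.1 hxC)).le
    exact ⟨p, ⟨hCK hpC, hp⟩, fun y hy => hsc.eq_of_isMinOn hy.2 hp hy.1 (hCK hpC)⟩
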